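/- **Definitions.** Let $M$ be a matroid on a finite ground set $E$, with lattice of flats $L(M)$ (ordered by inclusion, with least element $\hat 0=\operatorname{cl}(\emptyset)$, which is $\emptyset$ when $M$ has no loops) and Möbius function $\mu$ of $L(M)$. Its characteristic polynomial is $\chi_M(t)=\sum_{F\in L(M)}\mu(\hat 0,F)\,t^{\operatorname{rk}M-\operatorname{rk}F}$. For a flat $F$, let $M_F$ be the matroid on the ground set $F$ whose independent sets are the subsets of $F$ independent in $M$, and let $M^F$ be the contraction of $M$ by $F$, i.e. the matroid on $E\setminus F$ whose independent sets are the sets whose union with a basis of $F$ is independent in $M$. There is a unique way to assign to each such matroid $M$ a polynomial $P_M(t)\in\mathbb{Z}[t]$ such that 1. if $\operatorname{rk}M=0$, then $P_M(t)=1$; 2. if $\operatorname{rk}M>0$, then $\deg P_M(t)<\tfrac12\operatorname{rk}M$; 3. for every $M$, $t^{\operatorname{rk}M}P_M(t^{-1})=\sum_{F\in L(M)}\chi_{M_F}(t)\,P_{M^F}(t)$. The polynomial $P_M(t)$ is called the Kazhdan–Lusztig polynomial of $M$. For a finite simple graph $G$, write $P_G(t)$ for the Kazhdan–Lusztig polynomial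 of the graphical matroid of $G$, whose ground set is the edge set of $G$ and whose independent sets are the edge sets containing no cycle. Let $K_{2,n}$ be the complete bipartite graph with parts of sizes $2$ and $n$, and let the thagomizer graph $T_n$ be the graph obtained from $K_{2,n}$ by adding an edge joining the two vertices of the part of size $2$. **Theorem.** For every integer $n\ge 2$, $$P_{K_{2,n}}(t)=P_{T_n}(t)+t .$$ -/

import Mathlib

open Polynomial

namespace MatroidKL

/-! ### The lattice of flats and the characteristic polynomial

Matroids live on a finite type `α`; the ground set `M.E` is any subset of `α`. -/

section Flats

variable {α : Type*}

/-- The flats of `M`, ordered by inclusion. -/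
def Flat (M : Matroid α) : Type _ := {F : Set α // M.IsFlat F}

/-- The underlying set of a flat. -/
def Flat.set {M : Matroid α} (F : Flat M) : Set α := F.1

noncomputable instance (M : Matroid α) : PartialOrder (Flat M) :=
  inferInstanceAs (PartialOrder {F : Set α // M.IsFlat F})

/-- The least flat is the closure of the empty set (the empty set itself if `M` has no loops),
and the largest flat is the ground set. -/
noncomputable instance (M : Matroid α) : BoundedOrder (Flat M) where
  bot := ⟨M.closure ∅, M.isFlat_closure ∅⟩
  bot_le F := by
    change M.closure ∅ ⊆ F.1
    exact (M.closure_subset_closure (Set.empty_subset F.1)).trans F.2.closure.subset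
  top := ⟨M.E, M.ground_isFlat⟩
  le_top F := F.2.subset_ground

instance [Finite α] (M : Matroid α) : Finite (Flat M) :=
  inferInstanceAs (Finite {F : Set α // M.IsFlat F})

noncomputable instance [Finite α] (M : Matroid α) : Fintype (Flat M) := Fintype.ofFinite _

noncomputable instance (M : Matroid α) : DecidableEq (Flat M) := Classical.decEq _

open Classical in
noncomputable instance [Finite α] (M : Matroid α) : LocallyFiniteOrder (Flat M) :=
  Fintype.toLocallyFiniteOrder

/-- The rank of a set in `M`, as a natural number. -/
noncomputable def rk (M : Matroid α) (S : Set α) : ℕ := (M.eRk S).toNat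

/-- The rank of `M`, as a natural number. -/
noncomputable def rank (M : Matroid α) : ℕ := M.eRank.toNat

/-- The characteristic polynomial
`χ_M(t) = ∑_F μ(⊥, F) t ^ (rk M - rk F)`, the sum running over the flats `F` of `M`. -/
noncomputable def charPoly [Finite α] (M : Matroid α) : ℤ[X] :=
  ∑ F : Flat M, C (IncidenceAlgebra.mu ℤ (⊥ : Flat M) F) * X ^ (rank M - rk M F.set)

/-- The three conditions that characterize the assignment `M ↦ P_M(t)` of
Kazhdan–Lusztig polynomials: here `Polynomial.reflect (rank M) (P M)` is
`t ^ (rk M) * P_M(t⁻¹)`, the matroid `M.restrict F` is the localization `M_F` (on the ground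
set `F`), and `M.contract F` is the contraction `M^F` (on the ground set `M.E \ F`). -/
structure IsKLAssignment [Finite α] (P : Matroid α → ℤ[X]) : Prop where
  rank_zero : ∀ M, rank M = 0 → P M = 1
  degree_lt : ∀ M, 0 < rank M → 2 * (P M).natDegree < rank M
  reflect_eq : ∀ M, (P M).reflect (rank M) =
    ∑ F : Flat M, charPoly (M.restrict F.set) * P (M.contract F.set)

end Flats

/-! ### Existence and uniqueness of Kazhdan–Lusztig polynomials -/

section Existence

set_option linter.unusedSectionVars false

variable {α : Type*} [Finite α]

lemma eRk_ne_top (M : Matroid α) (S : Set α) : M.eRk S ≠ ⊤ := by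
  have h : S.encard ≠ ⊤ := Set.encard_ne_top_iff.2 S.toFinite
  exact ne_top_of_le_ne_top h (M.eRk_le_encard S)

lemma coe_rk (M : Matroid α) (S : Set α) : (rk M S : ℕ∞) = M.eRk S :=
  ENat.natCast_toNat (eRk_ne_top M S)

lemma rank_eq (M : Matroid α) : rank M = rk M M.E := by
  rw [rank, rk, Matroid.eRk_ground]

lemma rk_mono (M : Matroid α) {S T : Set α} (h : S ⊆ T) : rk M S ≤ rk M T := by
  rw [← Nat.cast_le (α := ℕ∞), coe_rk, coe_rk]
  exact M.eRk_mono h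

lemma rk_le_rank (M : Matroid α) (S : Set α) : rk M S ≤ rank M := by
  rw [← Nat.cast_le (α := ℕ∞), rank_eq, coe_rk, coe_rk, Matroid.eRk_ground]
  exact M.eRk_le_eRank S

lemma rank_restrict (M : Matroid α) (S : Set α) : rank (M.restrict S) = rk M S := rfl

lemma rk_restrict (M : Matroid α) {S R : Set α} (h : S ⊆ R) :
    rk (M.restrict R) S = rk M S := by
  rw [rk, M.restrict_eRk_eq h, rk]

lemma rk_contract_add (M : Matroid α) (F S : Set α) :
    rk (M.contract F) S + rk M F = rk M (S ∪ F) := by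
  obtain ⟨I, hI⟩ := M.exists_isBasis' F
  obtain ⟨J, hJ⟩ := (M.contract F).exists_isBasis' S
  have hJI := (hI.contract_indep_iff.1 hJ.indep)
  have hd : Disjoint J I := (hJI.2.mono_left hI.subset).symm
  have hb : M.eRk (S ∪ F) = (J ∪ I).encard := by
    rw [← hJI.1.eRk_eq_encard]
    refine le_antisymm ?_ (M.eRk_mono (Set.union_subset_union hJ.subset hI.subset))
    have h1 : M.closure (J ∪ I) = M.closure (J ∪ F) :=
      M.closure_union_congr_right hI.closure_eq_closure
    have h2 := hJ.closure_eq_closure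
    rw [M.contract_closure_eq, M.contract_closure_eq] at h2
    have h3 : (S ∪ F) ∩ M.E ⊆ M.closure (J ∪ F) := by
      rintro x ⟨hx, hxE⟩
      by_cases hxF : x ∈ F
      · exact M.mem_closure_of_mem' (Or.inr hxF) hxE
      · have : x ∈ M.closure (S ∪ F) \ F := ⟨M.mem_closure_of_mem' hx hxE, hxF⟩
        rw [← h2] at this
        exact this.1
    rw [← M.eRk_inter_ground, ← M.eRk_closure_eq (J ∪ I), h1]
    exact M.eRk_mono h3
  have : (rk (M.contract F) S + rk M F : ℕ∞) = rk M (S ∪ F) := by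
    rw [coe_rk, coe_rk, coe_rk, hb, Set.encard_union_eq hd, hJ.encard_eq_eRk, hI.encard_eq_eRk]
  exact_mod_cast this

lemma rank_contract_add (M : Matroid α) {F : Set α} (hF : F ⊆ M.E) :
    rank (M.contract F) + rk M F = rank M := by
  rw [rank_eq, rk_contract_add, Matroid.contract_ground, Set.sdiff_union_of_subset hF, rank_eq]

lemma Flat.subset_ground {M : Matroid α} (F : Flat M) : F.set ⊆ M.E := F.2.subset_ground

lemma Flat.closure_eq {M : Matroid α} (F : Flat M) : M.closure F.set = F.set := F.2.closure

lemma Flat.le_iff {M : Matroid α} {F G : Flat M} : F ≤ G ↔ F.set ⊆ G.set := Iff.rfl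

lemma Flat.ext {M : Matroid α} {F G : Flat M} (h : F.set = G.set) : F = G := Subtype.ext h

lemma rk_bot (M : Matroid α) : rk M (⊥ : Flat M).set = 0 := by
  change (M.eRk (M.closure ∅)).toNat = 0
  simp

lemma rk_pos (M : Matroid α) {F : Flat M} (h : F ≠ ⊥) : 0 < rk M F.set := by
  rw [Nat.pos_iff_ne_zero]
  intro h0
  apply h
  have h1 : M.eRk F.set = 0 := by rw [← coe_rk, h0]; rfl
  rw [Matroid.eRk_eq_zero_iff F.subset_ground] at h1
  exact le_antisymm h1 bot_le

lemma rank_contract_lt (M : Matroid α) {F : Flat M} (h : F ≠ ⊥) :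
    rank (M.contract F.set) < rank M := by
  have := rank_contract_add M F.subset_ground
  have := rk_pos M h
  omega

/-- Möbius functions agree along an order embedding onto a convex set. -/
lemma mu_map {A B : Type*} [PartialOrder A] [PartialOrder B] [LocallyFiniteOrder A]
    [LocallyFiniteOrder B] [DecidableEq A] [DecidableEq B] [Finite A] (φ : A ↪o B)
    (a : A) (hφ : ∀ c b, φ a ≤ b → b ≤ φ c → ∃ d, φ d = b) (c : A) :
    IncidenceAlgebra.mu ℤ (φ a) (φ c) = IncidenceAlgebra.mu ℤ a c := by
  induction c using WellFoundedLT.induction with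
  | ind c ih =>
    rw [IncidenceAlgebra.mu_apply, IncidenceAlgebra.mu_apply]
    simp only [EmbeddingLike.apply_eq_iff_eq]
    split_ifs with h
    · rfl
    · have : Finset.Ico (φ a) (φ c) = (Finset.Ico a c).map φ.toEmbedding := by
        ext b
        simp only [Finset.mem_Ico, Finset.mem_map, RelEmbedding.coe_toEmbedding]
        constructor
        · rintro ⟨h1, h2⟩
          obtain ⟨d, rfl⟩ := hφ c b h1 h2.le
          exact ⟨d, ⟨φ.le_iff_le.1 h1, φ.lt_iff_lt.1 h2⟩, rfl⟩
        · rintro ⟨d, ⟨h1, h2⟩, rfl⟩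
          exact ⟨φ.le_iff_le.2 h1, φ.lt_iff_lt.2 h2⟩
      rw [this, Finset.sum_map]
      congr 1
      refine Finset.sum_congr rfl fun d hd ↦ ?_
      exact ih d (Finset.mem_Ico.1 hd).2

/-- The characteristic polynomial of an interval of the lattice of flats. -/
noncomputable def kap (M : Matroid α) (F G : Flat M) : ℤ[X] :=
  ∑ H ∈ Finset.Icc F G, C (IncidenceAlgebra.mu ℤ F H) * X ^ (rk M G.set - rk M H.set)

lemma charPoly_eq_kap (M : Matroid α) : charPoly M = kap M ⊥ ⊤ := by
  rw [charPoly, kap, Finset.Icc_bot_top, rank_eq]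
  rfl

lemma kap_self (M : Matroid α) (F : Flat M) : kap M F F = 1 := by
  simp [kap]

lemma kap_map {M N : Matroid α} (φ : Flat N ↪o Flat M)
    (hφ : ∀ c b, φ ⊥ ≤ b → b ≤ φ c → ∃ d, φ d = b)
    (hr : ∀ G H, rk N G.set - rk N H.set = rk M (φ G).set - rk M (φ H).set) (G : Flat N) :
    kap N ⊥ G = kap M (φ ⊥) (φ G) := by
  have : Finset.Icc (φ ⊥) (φ G) = (Finset.Icc ⊥ G).map φ.toEmbedding := by
    ext b
    simp only [Finset.mem_Icc, Finset.mem_map, RelEmbedding.coe_toEmbedding]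
    constructor
    · rintro ⟨h1, h2⟩
      obtain ⟨d, rfl⟩ := hφ G b h1 h2
      exact ⟨d, ⟨φ.le_iff_le.1 h1, φ.le_iff_le.1 h2⟩, rfl⟩
    · rintro ⟨d, ⟨h1, h2⟩, rfl⟩
      exact ⟨φ.le_iff_le.2 h1, φ.le_iff_le.2 h2⟩
  rw [kap, kap, this, Finset.sum_map]
  refine Finset.sum_congr rfl fun H _ ↦ ?_
  rw [hr G H, RelEmbedding.coe_toEmbedding, mu_map φ ⊥ hφ]

lemma isFlat_restrict_iff (M : Matroid α) (G : Flat M) (S : Set α) :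
    (M.restrict G.set).IsFlat S ↔ M.IsFlat S ∧ S ⊆ G.set := by
  constructor
  · intro h
    have hS : S ⊆ G.set := h.subset_ground
    refine ⟨?_, hS⟩
    have h1 := h.closure
    rw [M.restrict_closure_eq hS G.subset_ground] at h1
    have h2 : M.closure S ⊆ G.set := (M.closure_subset_closure hS).trans G.closure_eq.subset
    rw [Set.inter_eq_left.2 h2] at h1
    exact Matroid.isFlat_iff_closure_eq.2 h1
  · rintro ⟨h, hS⟩
    rw [Matroid.isFlat_iff_closure_eq, M.restrict_closure_eq hS G.subset_ground, h.closure]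
    exact Set.inter_eq_left.2 hS

lemma isFlat_contract_iff (M : Matroid α) (F : Flat M) (S : Set α) :
    (M.contract F.set).IsFlat S ↔ M.IsFlat (S ∪ F.set) ∧ Disjoint S F.set := by
  rw [Matroid.isFlat_iff_closure_eq, M.contract_closure_eq, Matroid.isFlat_iff_closure_eq]
  constructor
  · intro h
    have hd : Disjoint S F.set := by rw [← h]; exact Set.disjoint_sdiff_left
    refine ⟨?_, hd⟩
    have : F.set ⊆ M.closure (S ∪ F.set) :=
      F.closure_eq.symm.subset.trans (M.closure_subset_closure Set.subset_union_right)
    calc M.closure (S ∪ F.set) = (M.closure (S ∪ F.set) \ F.set) ∪ F.set :=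
          (Set.sdiff_union_of_subset this).symm
      _ = S ∪ F.set := by rw [h]
  · rintro ⟨h, hd⟩
    rw [h, Set.union_sdiff_right, hd.sdiff_eq_left]

/-- Flats of the localization at `G` are the flats below `G`. -/
noncomputable def restrictEmb (M : Matroid α) (G : Flat M) :
    Flat (M.restrict G.set) ↪o Flat M where
  toFun H := ⟨H.set, ((isFlat_restrict_iff M G _).1 H.2).1⟩
  inj' H K h := by
    have h' : H.set = K.set := by
      have h'' := congrArg Flat.set h
      exact h''
    exact Flat.ext h'
  map_rel_iff' := Iff.rfl

/-- Flats of the contraction by `F` are the flats above `F`. -/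
noncomputable def contractEmb (M : Matroid α) (F : Flat M) :
    Flat (M.contract F.set) ↪o Flat M where
  toFun H := ⟨H.set ∪ F.set, ((isFlat_contract_iff M F _).1 H.2).1⟩
  inj' H K h := by
    have h' : H.set ∪ F.set = K.set ∪ F.set := congrArg Flat.set h
    have h1 := ((isFlat_contract_iff M F _).1 H.2).2
    have h2 := ((isFlat_contract_iff M F _).1 K.2).2
    refine Flat.ext ?_
    calc H.set = (H.set ∪ F.set) \ F.set := by rw [Set.union_sdiff_right]; exact h1.sdiff_eq_left.symm
      _ = (K.set ∪ F.set) \ F.set := by rw [h']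
      _ = K.set := by rw [Set.union_sdiff_right]; exact h2.sdiff_eq_left
  map_rel_iff' {H K} := by
    have h1 := ((isFlat_contract_iff M F _).1 H.2).2
    change H.set ∪ F.set ⊆ K.set ∪ F.set ↔ H.set ⊆ K.set
    refine ⟨fun h x hx ↦ ?_, fun h ↦ Set.union_subset_union_left _ h⟩
    rcases h (Or.inl hx) with h' | h'
    · exact h'
    · exact (Set.disjoint_left.1 h1 hx h').elim

lemma restrictEmb_set (M : Matroid α) (G : Flat M) (H) : (restrictEmb M G H).set = H.set := rfl

lemma contractEmb_set (M : Matroid α) (F : Flat M) (H) :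
    (contractEmb M F H).set = H.set ∪ F.set := rfl

lemma restrictEmb_bot (M : Matroid α) (G : Flat M) : restrictEmb M G ⊥ = ⊥ := by
  refine Flat.ext ?_
  change (M.restrict G.set).closure ∅ = M.closure ∅
  rw [M.restrict_closure_eq (Set.empty_subset _) G.subset_ground]
  exact Set.inter_eq_left.2 (bot_le (a := G))

lemma restrictEmb_top (M : Matroid α) (G : Flat M) : restrictEmb M G ⊤ = G := rfl

lemma contractEmb_bot (M : Matroid α) (F : Flat M) : contractEmb M F ⊥ = F := by
  refine Flat.ext ?_
  change (M.contract F.set).closure ∅ ∪ F.set = F.set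
  rw [M.contract_closure_eq, Set.empty_union, F.closure_eq]
  simp

lemma exists_contractEmb (M : Matroid α) {F G : Flat M} (h : F ≤ G) :
    ∃ H, contractEmb M F H = G := by
  have hG : G.set \ F.set ∪ F.set = G.set := Set.sdiff_union_of_subset h
  refine ⟨⟨G.set \ F.set, (isFlat_contract_iff M F _).2 ⟨?_, Set.disjoint_sdiff_left⟩⟩, ?_⟩
  · rw [hG]; exact G.2
  · exact Flat.ext hG

lemma le_contractEmb (M : Matroid α) (F : Flat M) (H) : F ≤ contractEmb M F H :=
  Set.subset_union_right

lemma charPoly_restrict (M : Matroid α) (G : Flat M) :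
    charPoly (M.restrict G.set) = kap M ⊥ G := by
  rw [charPoly_eq_kap, kap_map (restrictEmb M G), restrictEmb_bot, restrictEmb_top]
  · intro c b _ hb
    have : b.set ⊆ G.set := (Flat.le_iff.1 hb).trans c.subset_ground
    exact ⟨⟨b.set, (isFlat_restrict_iff M G _).2 ⟨b.2, this⟩⟩, rfl⟩
  · intro H K
    have hH : H.set ⊆ G.set := H.subset_ground
    have hK : K.set ⊆ G.set := K.subset_ground
    rw [rk_restrict M hH, rk_restrict M hK]
    rfl

lemma kap_contract (M : Matroid α) (F : Flat M) (H : Flat (M.contract F.set)) :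
    kap (M.contract F.set) ⊥ H = kap M F (contractEmb M F H) := by
  rw [kap_map (contractEmb M F), contractEmb_bot]
  · intro c b hb _
    rw [contractEmb_bot] at hb
    exact exists_contractEmb M hb
  · intro H K
    rw [contractEmb_set, contractEmb_set, ← rk_contract_add, ← rk_contract_add]
    omega

lemma contract_contractEmb (M : Matroid α) (F : Flat M) (H : Flat (M.contract F.set)) :
    (M.contract F.set).contract H.set = M.contract (contractEmb M F H).set := by
  rw [Matroid.contract_contract, contractEmb_set, Set.union_comm]

lemma sum_contract (M : Matroid α) (F : Flat M) (f : Flat M → ℤ[X]) :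
    ∑ H : Flat (M.contract F.set), f (contractEmb M F H) = ∑ G ∈ Finset.Icc F ⊤, f G := by
  have : Finset.Icc F ⊤ =
      Finset.univ.map (contractEmb M F).toEmbedding := by
    ext G
    simp only [Finset.mem_Icc, le_top, and_true, Finset.mem_univ, true_and, Finset.mem_map,
      RelEmbedding.coe_toEmbedding]
    exact ⟨exists_contractEmb M, by rintro ⟨H, rfl⟩; exact le_contractEmb M F H⟩
  rw [this, Finset.sum_map]
  rfl

lemma reflect_sum {ι : Type*} (s : Finset ι) (f : ι → ℤ[X]) (N : ℕ) :
    (∑ i ∈ s, f i).reflect N = ∑ i ∈ s, (f i).reflect N := by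
  classical
  induction s using Finset.induction_on with
  | empty => simp
  | insert a s ha ih => rw [Finset.sum_insert ha, Finset.sum_insert ha, reflect_add, ih]

/-- The reversed characteristic polynomial of the interval from `⊥` to `G`. -/
noncomputable def revKap (M : Matroid α) (G : Flat M) : ℤ[X] :=
  ∑ H ∈ Finset.Icc ⊥ G, C (IncidenceAlgebra.mu ℤ ⊥ H) * X ^ rk M H.set

lemma revKap_bot (M : Matroid α) : revKap M ⊥ = 1 := by
  simp [revKap, rk_bot]

lemma reflect_kap (M : Matroid α) (G : Flat M) :
    (kap M ⊥ G).reflect (rk M G.set) = revKap M G := by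
  rw [kap, reflect_sum, revKap]
  refine Finset.sum_congr rfl fun H hH ↦ ?_
  have : rk M H.set ≤ rk M G.set := rk_mono M (Finset.mem_Icc.1 hH).2
  rw [reflect_C_mul_X_pow, revAt_le (Nat.sub_le _ _)]
  congr 2
  omega

lemma natDegree_kap_le (M : Matroid α) (F G : Flat M) :
    (kap M F G).natDegree ≤ rk M G.set := by
  refine natDegree_sum_le_of_forall_le _ _ fun H _ ↦ ?_
  exact (natDegree_C_mul_X_pow_le _ _).trans (Nat.sub_le _ _)

/-- The characteristic polynomials form a kernel. -/
lemma sum_revKap_mul_kap (M : Matroid α) (K : Flat M) :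
    ∑ F ∈ Finset.Icc ⊥ K, revKap M F * kap M F K = if K = ⊥ then 1 else 0 := by
  have h1 : ∀ H ∈ Finset.Icc ⊥ K, (∑ F ∈ Finset.Icc H K,
      C (IncidenceAlgebra.mu ℤ ⊥ H) * X ^ rk M H.set * kap M F K) =
      C (IncidenceAlgebra.mu ℤ ⊥ H) * X ^ rk M K.set := by
    intro H hH
    have hHK := (Finset.mem_Icc.1 hH).2
    have h2 : ∑ F ∈ Finset.Icc H K, kap M F K = X ^ (rk M K.set - rk M H.set) := by
      simp only [kap]
      rw [Finset.sum_comm' (t' := Finset.Icc H K) (s' := fun L ↦ Finset.Icc H L)]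
      · have h3 : ∀ L ∈ Finset.Icc H K, (∑ F ∈ Finset.Icc H L,
            C (IncidenceAlgebra.mu ℤ F L) * (X : ℤ[X]) ^ (rk M K.set - rk M L.set)) =
            if H = L then X ^ (rk M K.set - rk M L.set) else 0 := by
          intro L _
          rw [← Finset.sum_mul, ← map_sum, IncidenceAlgebra.sum_Icc_mu_left]
          split_ifs <;> simp
        rw [Finset.sum_congr rfl h3, Finset.sum_ite_eq, if_pos (Finset.left_mem_Icc.2 hHK)]
      · intro F L
        simp only [Finset.mem_Icc]
        constructor
        · rintro ⟨⟨a, b⟩, c, d⟩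
          exact ⟨⟨a, c⟩, a.trans c, d⟩
        · rintro ⟨⟨a, b⟩, c, d⟩
          exact ⟨⟨a, b.trans d⟩, b, d⟩
    rw [← Finset.mul_sum, h2, mul_assoc, ← pow_add,
      Nat.add_sub_cancel' (rk_mono M (S := H.set) (T := K.set) hHK)]
  calc ∑ F ∈ Finset.Icc ⊥ K, revKap M F * kap M F K
      = ∑ F ∈ Finset.Icc ⊥ K, ∑ H ∈ Finset.Icc ⊥ F,
        C (IncidenceAlgebra.mu ℤ ⊥ H) * X ^ rk M H.set * kap M F K := by
        simp only [revKap, Finset.sum_mul]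
    _ = ∑ H ∈ Finset.Icc ⊥ K, ∑ F ∈ Finset.Icc H K,
        C (IncidenceAlgebra.mu ℤ ⊥ H) * X ^ rk M H.set * kap M F K := by
        refine Finset.sum_comm' fun F H ↦ ?_
        simp only [Finset.mem_Icc, bot_le, true_and]
        exact ⟨fun h ↦ ⟨⟨h.2, h.1⟩, h.2.trans h.1⟩, fun h ↦ ⟨h.1.2, h.1.1⟩⟩
    _ = ∑ H ∈ Finset.Icc ⊥ K, C (IncidenceAlgebra.mu ℤ ⊥ H) * X ^ rk M K.set :=
        Finset.sum_congr rfl h1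
    _ = if K = ⊥ then 1 else 0 := by
        rw [← Finset.sum_mul, ← map_sum, IncidenceAlgebra.sum_Icc_mu_right]
        by_cases h : K = ⊥
        · rw [if_pos h, if_pos h.symm, h, rk_bot]; simp
        · rw [if_neg h, if_neg (Ne.symm h)]; simp

/-- The part of the right-hand side of the recursion that involves matroids of smaller rank. -/
noncomputable def lowerSum (P : Matroid α → ℤ[X]) (M : Matroid α) : ℤ[X] :=
  ∑ F : {F : Flat M // F ≠ ⊥}, charPoly (M.restrict F.1.set) * P (M.contract F.1.set)

lemma lowerSum_eq (P : Matroid α → ℤ[X]) (M : Matroid α) :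
    lowerSum P M = ∑ F ∈ Finset.univ.erase ⊥, kap M ⊥ F * P (M.contract F.set) := by
  rw [lowerSum, Finset.sum_subtype (p := fun F : Flat M ↦ F ≠ ⊥) _ (by simp)]
  exact Finset.sum_congr rfl fun F _ ↦ by rw [charPoly_restrict]

lemma sum_eq_add_lowerSum (P : Matroid α → ℤ[X]) (M : Matroid α) :
    ∑ F : Flat M, charPoly (M.restrict F.set) * P (M.contract F.set) =
      P (M.contract (⊥ : Flat M).set) + lowerSum P M := by
  rw [lowerSum_eq, ← Finset.add_sum_erase _ _ (Finset.mem_univ (⊥ : Flat M)), charPoly_restrict,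
    kap_self, one_mul]
  congr 1
  exact Finset.sum_congr rfl fun F _ ↦ by rw [charPoly_restrict]

lemma natDegree_lowerSum_le (P : Matroid α → ℤ[X]) (M : Matroid α)
    (hd : ∀ F : Flat M, F ≠ ⊥ →
      (P (M.contract F.set)).natDegree ≤ rank (M.contract F.set)) :
    (lowerSum P M).natDegree ≤ rank M := by
  rw [lowerSum_eq]
  refine natDegree_sum_le_of_forall_le _ _ fun F hF ↦ ?_
  have h1 := natDegree_kap_le M ⊥ F
  have h2 := hd F (Finset.mem_erase.1 hF).1
  have h3 := rank_contract_add M F.subset_ground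
  exact natDegree_mul_le.trans (by omega)

lemma reflect_lowerSum (P : Matroid α → ℤ[X]) (M : Matroid α)
    (hd : ∀ F : Flat M, F ≠ ⊥ →
      (P (M.contract F.set)).natDegree ≤ rank (M.contract F.set))
    (hP : ∀ F : Flat M, F ≠ ⊥ → (P (M.contract F.set)).reflect (rank (M.contract F.set)) =
      ∑ H : Flat (M.contract F.set), charPoly ((M.contract F.set).restrict H.set) *
        P ((M.contract F.set).contract H.set)) :
    (lowerSum P M).reflect (rank M) = - lowerSum P M := by
  have h1 : ∀ F ∈ Finset.univ.erase (⊥ : Flat M),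
      (kap M ⊥ F * P (M.contract F.set)).reflect (rank M) =
      ∑ G ∈ Finset.Icc F ⊤, revKap M F * kap M F G * P (M.contract G.set) := by
    intro F hF
    have hF := (Finset.mem_erase.1 hF).1
    rw [← rank_contract_add M F.subset_ground, add_comm,
      reflect_mul _ _ (natDegree_kap_le M ⊥ F) (hd F hF), reflect_kap, hP F hF,
      ← sum_contract M F, Finset.mul_sum]
    refine Finset.sum_congr rfl fun H _ ↦ ?_
    rw [charPoly_restrict, kap_contract, contract_contractEmb, mul_assoc]
  rw [lowerSum_eq, reflect_sum, Finset.sum_congr rfl h1,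
    Finset.sum_comm' (t' := Finset.univ) (s' := fun G ↦ (Finset.Icc ⊥ G).erase ⊥)]
  · have h2 : ∀ G : Flat M, ∑ F ∈ (Finset.Icc ⊥ G).erase ⊥,
        revKap M F * kap M F G * P (M.contract G.set) =
        ((if G = ⊥ then 1 else 0) - kap M ⊥ G) * P (M.contract G.set) := by
      intro G
      rw [← Finset.sum_mul, ← sum_revKap_mul_kap M G,
        ← Finset.add_sum_erase _ _ (Finset.left_mem_Icc.2 (bot_le (a := G))), revKap_bot]
      ring
    rw [Finset.sum_congr rfl fun G _ ↦ h2 G,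
      ← Finset.add_sum_erase _ _ (Finset.mem_univ (⊥ : Flat M)), if_pos rfl, kap_self, sub_self,
      zero_mul, zero_add, ← Finset.sum_neg_distrib]
    refine Finset.sum_congr rfl fun G hG ↦ ?_
    rw [if_neg (Finset.mem_erase.1 hG).1]
    ring
  · intro F G
    simp

/-- Minus the part of `R` of degree less than `r / 2`. -/
noncomputable def negTrunc (r : ℕ) (R : ℤ[X]) : ℤ[X] :=
  ∑ i ∈ (Finset.range r).filter (fun i ↦ 2 * i < r), monomial i (-R.coeff i)

lemma coeff_negTrunc (r : ℕ) (R : ℤ[X]) (i : ℕ) :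
    (negTrunc r R).coeff i = if 2 * i < r then -R.coeff i else 0 := by
  simp only [negTrunc, finsetSum_coeff, coeff_monomial, Finset.sum_ite_eq', Finset.mem_filter,
    Finset.mem_range]
  refine if_congr ⟨fun h ↦ h.2, fun h ↦ ⟨by omega, h⟩⟩ rfl rfl

lemma natDegree_negTrunc {r : ℕ} (hr : 0 < r) (R : ℤ[X]) : 2 * (negTrunc r R).natDegree < r := by
  by_contra h
  have h1 : negTrunc r R ≠ 0 := by
    rintro h0
    rw [h0, natDegree_zero] at h
    omega
  apply leadingCoeff_ne_zero.2 h1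
  rw [leadingCoeff, coeff_negTrunc, if_neg h]

lemma reflect_negTrunc {r : ℕ} {R : ℤ[X]} (hd : R.natDegree ≤ r) (hR : R.reflect r = -R) :
    (negTrunc r R).reflect r = negTrunc r R + R := by
  ext i
  have hi : R.coeff (revAt r i) = -R.coeff i := by rw [← coeff_reflect, hR, coeff_neg]
  rw [coeff_reflect, coeff_add, coeff_negTrunc, coeff_negTrunc]
  rcases le_or_gt i r with h | h
  · rw [hi, revAt_le h]
    rw [revAt_le h] at hi
    split_ifs with h1 h2 h2
    · omega
    · ring
    · ring
    · have : r - i = i := by omega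
      rw [this] at hi
      omega
  · have : R.coeff i = 0 := coeff_eq_zero_of_natDegree_lt (by omega)
    rw [revAt_eq_self_of_lt h, this]
    simp

open Classical in
/-- A recursive construction of the Kazhdan–Lusztig polynomial, used to prove existence. -/
noncomputable def klAux (M : Matroid α) : ℤ[X] :=
  if rank M = 0 then 1 else
    negTrunc (rank M) (∑ F : {F : Flat M // F ≠ ⊥},
      charPoly (M.restrict F.1.set) * klAux (M.contract F.1.set))
termination_by rank M
decreasing_by exact rank_contract_lt M F.2

lemma klAux_of_rank_zero {M : Matroid α} (h : rank M = 0) : klAux M = 1 := by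
  rw [klAux, if_pos h]

lemma klAux_of_rank_pos {M : Matroid α} (h : 0 < rank M) :
    klAux M = negTrunc (rank M) (lowerSum klAux M) := by
  rw [klAux, if_neg h.ne', lowerSum]

lemma natDegree_klAux (M : Matroid α) (h : 0 < rank M) : 2 * (klAux M).natDegree < rank M := by
  rw [klAux_of_rank_pos h]
  exact natDegree_negTrunc h _

lemma natDegree_klAux_le (M : Matroid α) : (klAux M).natDegree ≤ rank M := by
  rcases Nat.eq_zero_or_pos (rank M) with h | h
  · rw [klAux_of_rank_zero h]; simp
  · have := natDegree_klAux M h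
    omega

lemma rank_contract_bot (M : Matroid α) : rank (M.contract (⊥ : Flat M).set) = rank M := by
  have := rank_contract_add M (⊥ : Flat M).subset_ground
  rwa [rk_bot, add_zero] at this

lemma flat_eq_bot {M : Matroid α} (h : rank M = 0) (F : Flat M) : F = ⊥ := by
  by_contra hF
  have := rk_pos M hF
  have := rk_le_rank M F.set
  omega

/-- Contracting the loops does not change the lower part of the recursion. -/
lemma lowerSum_contract_bot (P : Matroid α → ℤ[X]) (M : Matroid α) :
    lowerSum P (M.contract (⊥ : Flat M).set) = lowerSum P M := by
  have h1 : ∑ H : Flat (M.contract (⊥ : Flat M).set),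
      charPoly ((M.contract (⊥ : Flat M).set).restrict H.set) *
        P ((M.contract (⊥ : Flat M).set).contract H.set) =
      ∑ F : Flat M, charPoly (M.restrict F.set) * P (M.contract F.set) := by
    have := sum_contract M ⊥ fun F ↦ charPoly (M.restrict F.set) * P (M.contract F.set)
    rw [Finset.Icc_bot_top] at this
    rw [← this]
    refine Finset.sum_congr rfl fun H _ ↦ ?_
    rw [charPoly_restrict, charPoly_restrict, kap_contract, contract_contractEmb]
  rw [sum_eq_add_lowerSum, sum_eq_add_lowerSum, contract_contractEmb, contractEmb_bot] at h1
  exact add_left_cancel h1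

lemma klAux_contract_bot (M : Matroid α) : klAux (M.contract (⊥ : Flat M).set) = klAux M := by
  rcases Nat.eq_zero_or_pos (rank M) with h | h
  · rw [klAux_of_rank_zero h, klAux_of_rank_zero (by rw [rank_contract_bot, h])]
  · rw [klAux_of_rank_pos h, klAux_of_rank_pos (by rw [rank_contract_bot]; exact h),
      rank_contract_bot, lowerSum_contract_bot]

lemma reflect_klAux (M : Matroid α) : (klAux M).reflect (rank M) =
    ∑ F : Flat M, charPoly (M.restrict F.set) * klAux (M.contract F.set) := by
  induction hn : rank M using Nat.strong_induction_on generalizing M with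
  | _ n ih =>
    subst hn
    rw [sum_eq_add_lowerSum, klAux_contract_bot]
    rcases Nat.eq_zero_or_pos (rank M) with h | h
    · have h0 : lowerSum klAux M = 0 := by
        rw [lowerSum_eq]
        refine Finset.sum_eq_zero fun F hF ↦ ?_
        exact ((Finset.mem_erase.1 hF).1 (flat_eq_bot h F)).elim
      rw [h0, klAux_of_rank_zero h, h]
      simp
    · have hd := natDegree_lowerSum_le klAux M fun F _ ↦ natDegree_klAux_le _
      have hR := reflect_lowerSum klAux M (fun F _ ↦ natDegree_klAux_le _)
        fun F hF ↦ ih _ (rank_contract_lt M hF) _ rfl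
      rw [klAux_of_rank_pos h]
      exact reflect_negTrunc hd hR

lemma isKLAssignment_klAux : IsKLAssignment (klAux : Matroid α → ℤ[X]) where
  rank_zero _ h := klAux_of_rank_zero h
  degree_lt M h := natDegree_klAux M h
  reflect_eq M := reflect_klAux M

lemma eq_negTrunc {r : ℕ} {p R : ℤ[X]} (hp : 2 * p.natDegree < r)
    (h : p.reflect r = p + R) : p = negTrunc r R := by
  ext i
  rw [coeff_negTrunc]
  split_ifs with hi
  · have h1 := congrArg (fun q ↦ coeff q i) h
    simp only [coeff_reflect, coeff_add] at h1
    rw [revAt_le (by omega), coeff_eq_zero_of_natDegree_lt (p := p) (n := r - i) (by omega)] at h1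
    omega
  · exact coeff_eq_zero_of_natDegree_lt (by omega)

lemma IsKLAssignment.eq_klAux {P : Matroid α → ℤ[X]} (hP : IsKLAssignment P) (M : Matroid α) :
    P M = klAux M := by
  induction hn : rank M using Nat.strong_induction_on generalizing M with
  | _ n ih =>
    subst hn
    rcases Nat.eq_zero_or_pos (rank M) with h | h
    · rw [hP.rank_zero M h, klAux_of_rank_zero h]
    have key : ∀ N : Matroid α, rank N = rank M → lowerSum P N = lowerSum klAux N := by
      intro N hN
      rw [lowerSum, lowerSum]
      refine Finset.sum_congr rfl fun F _ ↦ ?_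
      rw [ih _ (hN ▸ rank_contract_lt N F.2) _ rfl]
    -- first for the contraction by the loops
    have h1 : P (M.contract (⊥ : Flat M).set) = klAux (M.contract (⊥ : Flat M).set) := by
      set N := M.contract (⊥ : Flat M).set with hN
      have hr : rank N = rank M := rank_contract_bot M
      have hNb : N.contract (⊥ : Flat N).set = N := by
        rw [hN, contract_contractEmb, contractEmb_bot]
      have h2 := hP.reflect_eq N
      rw [sum_eq_add_lowerSum, hNb, key N hr] at h2
      rw [klAux_of_rank_pos (hr ▸ h)]
      exact eq_negTrunc (hP.degree_lt N (hr ▸ h)) h2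
    have h2 := hP.reflect_eq M
    have h3 := reflect_klAux M
    rw [sum_eq_add_lowerSum, h1, key M rfl, ← sum_eq_add_lowerSum, ← h3] at h2
    rw [← reflect_reflect (N := rank M) (p := P M), h2, reflect_reflect]

/-- There is exactly one assignment of Kazhdan–Lusztig polynomials. -/
theorem existsUnique_isKLAssignment : ∃! P : Matroid α → ℤ[X], IsKLAssignment P :=
  ⟨klAux, isKLAssignment_klAux, fun _ hP ↦ funext hP.eq_klAux⟩

/-- The Kazhdan–Lusztig polynomial `P_M(t)` of a matroid `M`. -/
noncomputable def klPolynomial (M : Matroid α) : ℤ[X] :=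
  existsUnique_isKLAssignment.choose M

lemma isKLAssignment_klPolynomial : IsKLAssignment (klPolynomial : Matroid α → ℤ[X]) :=
  existsUnique_isKLAssignment.choose_spec.1

end Existence

/-! ### Graphical matroids -/

section Graphic

variable {V : Type*}

/-- A set of edges of `G` is independent if it contains no cycle, that is, if it is the edge set
of a forest. -/
def IsForest (G : SimpleGraph V) (I : Set (Sym2 V)) : Prop :=
  I ⊆ G.edgeSet ∧ (SimpleGraph.fromEdgeSet I).IsAcyclic

open Classical in
/-- The vector `e_u + e_v` of the edge `uv`, over the field with two elements; used to prove the
augmentation property of forests. -/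
noncomputable def edgeVec : Sym2 V → (V → ZMod 2) :=
  Sym2.lift ⟨fun u v ↦ Pi.single u 1 + Pi.single v 1, fun _ _ ↦ add_comm _ _⟩

lemma edgeVec_mem_span_of_reachable (I : Set (Sym2 V)) {u v : V}
    (h : (SimpleGraph.fromEdgeSet I).Reachable u v) :
    edgeVec s(u, v) ∈ Submodule.span (ZMod 2) (edgeVec '' I) := by
  classical
  obtain ⟨p⟩ := h
  induction p with
  | nil =>
    have : edgeVec s(‹V›, ‹V›) = 0 := by
      simp only [edgeVec, Sym2.lift_mk]
      exact funext fun _ ↦ CharTwo.add_self_eq_zero _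
    simp [this]
  | @cons a b c hab p ih =>
    have h1 : s(a, b) ∈ I := ((SimpleGraph.fromEdgeSet_adj I).1 hab).1
    have h2 : edgeVec s(a, c) = edgeVec s(a, b) + edgeVec s(b, c) := by
      simp only [edgeVec, Sym2.lift_mk]
      have : (Pi.single b 1 : V → ZMod 2) + Pi.single b 1 = 0 :=
        funext fun _ ↦ CharTwo.add_self_eq_zero _
      linear_combination (-1 : V → ZMod 2) * this
    rw [h2]
    exact Submodule.add_mem _ (Submodule.subset_span ⟨_, h1, rfl⟩) ih

lemma linearIndependent_edgeVec [Finite V] (G : SimpleGraph V) {J : Set (Sym2 V)}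
    (hJ : IsForest G J) : LinearIndependent (ZMod 2) (fun e : J ↦ edgeVec e.1) := by
  classical
  have := Fintype.ofFinite V
  rw [linearIndependent_iff_notMem_span]
  rintro ⟨e, he⟩ hmem
  induction e using Sym2.ind with
  | _ u v =>
  have hadj : (SimpleGraph.fromEdgeSet J).Adj u v :=
    (SimpleGraph.fromEdgeSet_adj J).2 ⟨he, (hJ.1 he : G.Adj u v).ne⟩
  have hbr := SimpleGraph.isAcyclic_iff_forall_isBridge.1 hJ.2
    ((SimpleGraph.mem_edgeSet _).2 hadj)
  rw [SimpleGraph.isBridge_iff] at hbr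
  set H := (SimpleGraph.fromEdgeSet J).deleteEdges {s(u, v)} with hH
  let φ : (V → ZMod 2) →ₗ[ZMod 2] ZMod 2 :=
    ∑ w with H.Reachable u w, LinearMap.proj w
  have hφ : ∀ a b, φ (edgeVec s(a, b)) =
      (if H.Reachable u a then 1 else 0) + (if H.Reachable u b then 1 else 0) := by
    intro a b
    simp [φ, edgeVec, Finset.sum_add_distrib, Pi.single_apply, Finset.sum_ite_eq']
  have h0 : φ (edgeVec s(u, v)) = 1 := by
    rw [hφ, if_pos (SimpleGraph.Reachable.refl u), if_neg hbr, add_zero]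
  have hker : Submodule.span (ZMod 2)
      ((fun e : J ↦ edgeVec e.1) '' (Set.univ \ {⟨s(u, v), he⟩})) ≤ LinearMap.ker φ := by
    rw [Submodule.span_le]
    rintro _ ⟨⟨f, hf⟩, hne, rfl⟩
    induction f using Sym2.ind with
    | _ a b =>
    have hab : H.Adj a b := by
      rw [hH, SimpleGraph.deleteEdges_adj, SimpleGraph.fromEdgeSet_adj]
      refine ⟨⟨hf, (hJ.1 hf : G.Adj a b).ne⟩, fun h ↦ hne.2 ?_⟩
      exact Subtype.ext h
    have hiff : H.Reachable u a ↔ H.Reachable u b :=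
      ⟨fun h ↦ h.trans hab.reachable, fun h ↦ h.trans hab.symm.reachable⟩
    change φ (edgeVec s(a, b)) = 0
    rw [hφ, if_congr hiff rfl rfl]
    exact CharTwo.add_self_eq_zero _
  have := hker hmem
  rw [LinearMap.mem_ker] at this
  exact one_ne_zero (h0.symm.trans this)

lemma IsForest.exists_insert [Finite V] {G : SimpleGraph V} {I J : Set (Sym2 V)}
    (hI : IsForest G I) (hJ : IsForest G J) (hlt : I.ncard < J.ncard) :
    ∃ e ∈ J, e ∉ I ∧ IsForest G (insert e I) := by
  classical
  have := Fintype.ofFinite V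
  by_contra! hcon
  have hspan : Set.range (fun e : J ↦ edgeVec e.1) ≤
      Submodule.span (ZMod 2) (edgeVec '' I) := by
    rintro _ ⟨⟨e, he⟩, rfl⟩
    induction e using Sym2.ind with
    | _ u v =>
    by_cases heI : s(u, v) ∈ I
    · exact Submodule.subset_span ⟨_, heI, rfl⟩
    · refine edgeVec_mem_span_of_reachable I ?_
      by_contra hr
      refine hcon _ he heI ⟨Set.insert_subset (hJ.1 he) hI.1, ?_⟩
      have h1 := hI.2.sup_edge_of_not_reachable hr
      rwa [SimpleGraph.edge, ← SimpleGraph.fromEdgeSet_union, Set.union_singleton] at h1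
  have h1 := linearIndependent_le_span' _ (linearIndependent_edgeVec G hJ) (edgeVec '' I) hspan
  rw [Cardinal.mk_fintype, Nat.cast_le, ← Nat.card_eq_fintype_card, ← Nat.card_eq_fintype_card,
    Nat.card_coe_set_eq, Nat.card_coe_set_eq] at h1
  have h2 : (edgeVec '' I).ncard ≤ I.ncard := Set.ncard_image_le I.toFinite
  omega

/-- The graphical matroid of a finite simple graph `G`: its ground set is the set of edges of `G`,
and a set of edges is independent if it contains no cycle. -/
noncomputable def graphicMatroid [Finite V] (G : SimpleGraph V) : Matroid (Sym2 V) :=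
  (IndepMatroid.ofFinite (E := G.edgeSet) (Set.toFinite _) (IsForest G)
    (indep_empty := ⟨Set.empty_subset _, by
      rw [SimpleGraph.fromEdgeSet_empty]; exact SimpleGraph.isAcyclic_bot⟩)
    (indep_subset := fun _ _ hJ hIJ ↦
      ⟨hIJ.trans hJ.1, hJ.2.anti (SimpleGraph.fromEdgeSet_mono hIJ)⟩)
    (indep_aug := fun _ _ hI hJ hlt ↦ hI.exists_insert hJ hlt)
    (subset_ground := fun _ hI ↦ hI.1)).matroid

lemma graphicMatroid_ground [Finite V] (G : SimpleGraph V) :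
    (graphicMatroid G).E = G.edgeSet := rfl

lemma graphicMatroid_indep_iff [Finite V] (G : SimpleGraph V) (I : Set (Sym2 V)) :
    (graphicMatroid G).Indep I ↔
      I ⊆ G.edgeSet ∧ (SimpleGraph.fromEdgeSet I).IsAcyclic := Iff.rfl

/-- The thagomizer graph `T_n`: the complete bipartite graph `K_{2,n}` together with an edge
joining the two vertices of the part of size two. -/
def thagomizerGraph (n : ℕ) : SimpleGraph (Fin 2 ⊕ Fin n) :=
  completeBipartiteGraph (Fin 2) (Fin n) ⊔ SimpleGraph.edge (Sum.inl 0) (Sum.inl 1)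

end Graphic

end MatroidKL

/-!
Let `M` be the graphical matroid of the thagomizer graph `T_n`. It consists of the spine `e`, which
joins the two vertices of the part of size two, and of `n` pairs of spikes; each pair forms a
triangle with `e`. The matroid `N` of `K_{2,n}` is the deletion of `e`. A flat of `M` that contains
`e` and some spike contains a triangle, hence is spanned by its spikes, so taking closures in `M`
identifies the ranked lattice of flats of `N` with that of `M` with the single atom `{e}` removed
(`exists_restrictClosureEmb_iff`).

For matroids related in this way, `klAux_eq_add_of_range_eq_compl_atom` shows
`P_N = P_M + t * P_{M/e}` under a bound on the degree of `P_{M/e}`. Indeed, removing the atom `a`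
adds `μ(a, F)` to the Möbius function `μ(⊥, F)`, and therefore the characteristic polynomial of the
interval `[a, F]` to that of `[⊥, F]`; the contractions by flats other than `⊥` and `a` have the
same lattice of flats in `M` and in `N`, hence the same Kazhdan–Lusztig polynomials. Subtracting
the recursion for `P_M` from that for `P_N`, the terms with `[a, F]` add up to the recursion for
`P_{M/e}`, and `P_N - P_M - t * P_{M/e}` is found to be symmetric with respect to
`f(t) ↦ t ^ (rk M) f(t⁻¹)` while having degree less than `rk M / 2`, so it vanishes.

Finally, the flats of `M` above `{e}` form a Boolean lattice, since a flat that contains `e` and one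
spike of a pair contains the other one. By `klAux_contract_of_boolean`, `P_{M/e} = 1`. The
hypothesis `2 ≤ n` ensures that `t` satisfies the degree bound.

The lemmas are stated for `klAux`, the recursively defined function, which is equal to
`klPolynomial` by uniqueness.
-/

namespace MatroidKL

/-! ### Kazhdan–Lusztig polynomials along the lattice of flats -/

section KazhdanLusztig

variable {α : Type*} [Finite α]

/-- The recursion for the contraction by `F`, written as a sum over the flats of `M` above `F`. -/
lemma reflect_klAux_contract (M : Matroid α) (F : Flat M) :
    (klAux (M.contract F.set)).reflect (rank M - rk M F.set) =
      ∑ G ∈ Finset.Icc F ⊤, kap M F G * klAux (M.contract G.set) := by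
  have hr := rank_contract_add M F.subset_ground
  rw [show rank M - rk M F.set = rank (M.contract F.set) by omega, reflect_klAux,
    ← sum_contract M F]
  refine Finset.sum_congr rfl fun H _ ↦ ?_
  rw [charPoly_restrict, kap_contract, contract_contractEmb]

/-- The recursion for the contraction by `F` with the term of the flat `F` itself split off. -/
lemma reflect_klAux_contract_eq_add (M : Matroid α) (F : Flat M) :
    (klAux (M.contract F.set)).reflect (rank M - rk M F.set) =
      klAux (M.contract F.set) +
        ∑ G ∈ (Finset.Icc F ⊤).erase F, kap M F G * klAux (M.contract G.set) := by
  rw [reflect_klAux_contract,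
    ← Finset.add_sum_erase _ _ (Finset.left_mem_Icc.2 (le_top (a := F))), kap_self, one_mul]

lemma eq_zero_of_reflect_eq_self {r : ℕ} {p : ℤ[X]} (hp : 2 * p.natDegree < r)
    (h : p.reflect r = p) : p = 0 := by
  rw [eq_negTrunc hp (R := 0) (by rw [h, add_zero])]
  ext i
  simp [coeff_negTrunc]

/-- Uniqueness in the recursion: a polynomial satisfying the degree bound and having the same
defect of symmetry is the same polynomial. -/
lemma eq_of_reflect_sub_eq {r : ℕ} {p q : ℤ[X]} (hp : 2 * p.natDegree < r)
    (hq : 2 * q.natDegree < r) (h : p.reflect r - p = q.reflect r - q) : p = q := by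
  rw [← sub_eq_zero]
  have := natDegree_sub_le p q
  refine eq_zero_of_reflect_eq_self (r := r) (by omega) ?_
  rw [reflect_sub]
  linear_combination h

lemma kap_eq_zero {M : Matroid α} {F G : Flat M} (h : ¬ F ≤ G) : kap M F G = 0 := by
  rw [kap, Finset.Icc_eq_empty h, Finset.sum_empty]

/-- Möbius inversion of the definition of the characteristic polynomials of intervals. -/
lemma sum_Icc_kap (M : Matroid α) {H K : Flat M} (hHK : H ≤ K) :
    ∑ F ∈ Finset.Icc H K, kap M F K = X ^ (rk M K.set - rk M H.set) := by
  simp only [kap]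
  rw [Finset.sum_comm' (t' := Finset.Icc H K) (s' := fun L ↦ Finset.Icc H L)]
  · have h3 : ∀ L ∈ Finset.Icc H K, (∑ F ∈ Finset.Icc H L,
        C (IncidenceAlgebra.mu ℤ F L) * (X : ℤ[X]) ^ (rk M K.set - rk M L.set)) =
        if H = L then X ^ (rk M K.set - rk M L.set) else 0 := by
      intro L _
      rw [← Finset.sum_mul, ← map_sum, IncidenceAlgebra.sum_Icc_mu_left]
      split_ifs <;> simp
    rw [Finset.sum_congr rfl h3, Finset.sum_ite_eq, if_pos (Finset.left_mem_Icc.2 hHK)]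
  · intro F L
    simp only [Finset.mem_Icc]
    exact ⟨fun h ↦ ⟨⟨h.1.1, h.2.1⟩, h.1.1.trans h.2.1, h.2.2⟩,
      fun h ↦ ⟨⟨h.1.1, h.1.2.trans h.2.2⟩, h.1.2, h.2.2⟩⟩

lemma klAux_contract_of_rank_eq {M : Matroid α} {F : Flat M} (h : rank M = rk M F.set) :
    klAux (M.contract F.set) = 1 := by
  have := rank_contract_add M F.subset_ground
  exact klAux_of_rank_zero (by omega)

lemma two_mul_natDegree_klAux_contract {M : Matroid α} {F : Flat M} (h : rk M F.set < rank M) :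
    2 * (klAux (M.contract F.set)).natDegree < rank M - rk M F.set := by
  have := rank_contract_add M F.subset_ground
  have := natDegree_klAux (M.contract F.set) (by omega)
  omega

/-! ### Intervals of the lattice of flats that agree -/

lemma map_Icc {A B : Type*} [PartialOrder A] [PartialOrder B] [LocallyFiniteOrder A]
    [LocallyFiniteOrder B] (φ : A ↪o B) (a c : A)
    (hφ : ∀ b, φ a ≤ b → b ≤ φ c → ∃ d, φ d = b) :
    Finset.Icc (φ a) (φ c) = (Finset.Icc a c).map φ.toEmbedding := by
  ext b
  simp only [Finset.mem_Icc, Finset.mem_map, RelEmbedding.coe_toEmbedding]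
  constructor
  · rintro ⟨h1, h2⟩
    obtain ⟨d, rfl⟩ := hφ b h1 h2
    exact ⟨d, ⟨φ.le_iff_le.1 h1, φ.le_iff_le.1 h2⟩, rfl⟩
  · rintro ⟨d, ⟨h1, h2⟩, rfl⟩
    exact ⟨φ.le_iff_le.2 h1, φ.le_iff_le.2 h2⟩

/-- The Kazhdan–Lusztig polynomial of the contraction by `F` depends only on the interval
of the ranked lattice of flats above `F`. -/
lemma klAux_contract_map {M N : Matroid α} (φ : Flat N ↪o Flat M)
    (hr : ∀ F, rk N F.set = rk M (φ F).set) (F : Flat N)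
    (hF : ∀ G, φ F ≤ G → ∃ H, φ H = G) :
    klAux (N.contract F.set) = klAux (M.contract (φ F).set) := by
  have htop : φ ⊤ = ⊤ := by
    obtain ⟨H, hH⟩ := hF ⊤ le_top
    exact top_le_iff.1 (hH ▸ φ.le_iff_le.2 le_top)
  have hrank : rank N = rank M := by
    have := hr ⊤
    rw [htop] at this
    exact (rank_eq N).trans (this.trans (rank_eq M).symm)
  induction F using WellFoundedGT.induction with
  | ind F ih =>
  rcases (rk_le_rank N F.set).eq_or_lt with h | h
  · rw [klAux_contract_of_rank_eq h.symm,
      klAux_contract_of_rank_eq (by rw [← hr, ← hrank, h])]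
  have e : rank N - rk N F.set = rank M - rk M (φ F).set := by rw [hr, hrank]
  refine eq_of_reflect_sub_eq (two_mul_natDegree_klAux_contract h)
    (e ▸ two_mul_natDegree_klAux_contract (by rw [← hr, ← hrank]; exact h)) ?_
  conv_rhs => rw [e]
  rw [reflect_klAux_contract_eq_add, reflect_klAux_contract_eq_add, add_sub_cancel_left,
    add_sub_cancel_left]
  have hIcc : (Finset.Icc (φ F) ⊤).erase (φ F) =
      ((Finset.Icc F ⊤).erase F).map φ.toEmbedding := by
    rw [← htop, map_Icc φ F ⊤ fun b hb _ ↦ hF b hb, Finset.map_erase]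
    rfl
  rw [hIcc, Finset.sum_map]
  refine Finset.sum_congr rfl fun G hG ↦ ?_
  have hFG : F < G := lt_of_le_of_ne (Finset.mem_Icc.1 (Finset.mem_erase.1 hG).2).1
    (Finset.mem_erase.1 hG).1.symm
  have hkap : kap N F G = kap M (φ F) (φ G) := by
    rw [kap, kap, map_Icc φ F G fun b hb _ ↦ hF b hb, Finset.sum_map]
    refine Finset.sum_congr rfl fun H _ ↦ ?_
    rw [hr, hr, RelEmbedding.coe_toEmbedding, mu_map φ F fun c b hb _ ↦ hF b hb]
  rw [hkap, ih G hFG fun K hK ↦ hF K ((φ.le_iff_le.2 hFG.le).trans hK)]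
  rfl

/-! ### Removing an atom from the lattice of flats -/

/-- The correction term of `mu_of_range_eq_compl_atom` makes the summand at the missing atom
vanish, so that sums may be extended over it. -/
lemma mu_bot_add_mu_self_of_isAtom {B : Type*} [PartialOrder B] [OrderBot B]
    [LocallyFiniteOrder B] [DecidableEq B] {a : B} (ha : IsAtom a) :
    IncidenceAlgebra.mu ℤ ⊥ a + IncidenceAlgebra.mu ℤ a a = 0 := by
  have : Finset.Ico (⊥ : B) a = {⊥} := by
    ext b
    simp only [Finset.mem_Ico, bot_le, true_and, Finset.mem_singleton]
    exact ha.lt_iff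
  rw [IncidenceAlgebra.mu_eq_neg_sum_Ico_of_ne ha.1.symm, this]
  simp

lemma erase_Icc_bot_of_range_eq_compl {A B : Type*} [PartialOrder A] [PartialOrder B]
    [OrderBot A] [OrderBot B] [LocallyFiniteOrder A] [LocallyFiniteOrder B] [DecidableEq B]
    (φ : A ↪o B) {a : B} (hφ : ∀ b, (∃ c, φ c = b) ↔ b ≠ a) (c : A) :
    (Finset.Icc ⊥ (φ c)).erase a = (Finset.Icc ⊥ c).map φ.toEmbedding := by
  ext b
  simp only [Finset.mem_erase, Finset.mem_Icc, bot_le, true_and, Finset.mem_map,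
    RelEmbedding.coe_toEmbedding, ← hφ]
  constructor
  · rintro ⟨⟨d, rfl⟩, h⟩
    exact ⟨d, φ.le_iff_le.1 h, rfl⟩
  · rintro ⟨d, h, rfl⟩
    exact ⟨⟨d, rfl⟩, φ.le_iff_le.2 h⟩

/-- Removing the atom `a` adds `μ(a, c)` to the Möbius function `μ(⊥, c)`; this is zero
unless `a ≤ c`. -/
lemma mu_of_range_eq_compl_atom {A B : Type*} [PartialOrder A] [PartialOrder B] [OrderBot A]
    [OrderBot B] [LocallyFiniteOrder A] [LocallyFiniteOrder B] [DecidableEq A] [DecidableEq B]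
    [Finite A] (φ : A ↪o B) {a : B} (ha : IsAtom a) (hbot : φ ⊥ = ⊥)
    (hφ : ∀ b, (∃ c, φ c = b) ↔ b ≠ a) (c : A) :
    IncidenceAlgebra.mu ℤ ⊥ c =
      IncidenceAlgebra.mu ℤ ⊥ (φ c) + IncidenceAlgebra.mu ℤ a (φ c) := by
  have hmua : ∀ b : B, ¬ a ≤ b → IncidenceAlgebra.mu ℤ a b = 0 := fun b hb ↦
    IncidenceAlgebra.apply_eq_zero_of_not_le hb _
  induction c using WellFoundedLT.induction with
  | ind c ih =>
  rcases eq_or_ne c ⊥ with rfl | hc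
  · rw [hbot, hmua _ fun h ↦ ha.1 (le_bot_iff.1 h)]
    simp
  have hc' : φ c ≠ ⊥ := by rw [← hbot]; exact fun h ↦ hc (φ.injective h)
  have hca : φ c ≠ a := (hφ _).1 ⟨c, rfl⟩
  have h1 := IncidenceAlgebra.sum_Icc_mu_right (𝕜 := ℤ) ⊥ c
  have h2 := IncidenceAlgebra.sum_Icc_mu_right (𝕜 := ℤ) ⊥ (φ c)
  have h3 := IncidenceAlgebra.sum_Icc_mu_right (𝕜 := ℤ) a (φ c)
  rw [if_neg hc.symm] at h1
  rw [if_neg hc'.symm] at h2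
  rw [if_neg hca.symm] at h3
  have h3' : ∑ x ∈ Finset.Icc ⊥ (φ c), IncidenceAlgebra.mu ℤ a x = 0 := by
    rw [← h3]
    refine (Finset.sum_subset (Finset.Icc_subset_Icc_left bot_le) fun x hx hx' ↦ ?_).symm
    exact hmua x fun h ↦ hx' (Finset.mem_Icc.2 ⟨h, (Finset.mem_Icc.1 hx).2⟩)
  have h4 : ∑ x ∈ (Finset.Icc ⊥ (φ c)).erase a,
      (IncidenceAlgebra.mu ℤ ⊥ x + IncidenceAlgebra.mu ℤ a x) = 0 := by
    -- the term of the missing element vanishes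
    rw [Finset.sum_erase (f := fun x ↦ IncidenceAlgebra.mu ℤ ⊥ x + IncidenceAlgebra.mu ℤ a x) _
      (mu_bot_add_mu_self_of_isAtom ha), Finset.sum_add_distrib, h2, h3', add_zero]
  rw [erase_Icc_bot_of_range_eq_compl φ hφ, Finset.sum_map] at h4
  have hmem : c ∈ Finset.Icc ⊥ c := Finset.right_mem_Icc.2 bot_le
  rw [← Finset.add_sum_erase _ _ hmem] at h1 h4
  have h6 : ∀ x ∈ (Finset.Icc ⊥ c).erase c, IncidenceAlgebra.mu ℤ ⊥ (φ.toEmbedding x) +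
      IncidenceAlgebra.mu ℤ a (φ.toEmbedding x) = IncidenceAlgebra.mu ℤ ⊥ x := fun x hx ↦
    (ih x (lt_of_le_of_ne (Finset.mem_Icc.1 (Finset.mem_erase.1 hx).2).2
      (Finset.mem_erase.1 hx).1)).symm
  rw [Finset.sum_congr rfl h6] at h4
  exact add_right_cancel (h1.trans h4.symm)

/-- Removing the atom `A` from the lattice of flats adds the characteristic polynomial of the
interval from `A` to `F` to that of the interval from `⊥` to `F`. -/
lemma kap_of_range_eq_compl_atom {M N : Matroid α} (φ : Flat N ↪o Flat M)
    (hr : ∀ F, rk N F.set = rk M (φ F).set) {A : Flat M} (hA : IsAtom A) (hbot : φ ⊥ = ⊥)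
    (hφ : ∀ G, (∃ F, φ F = G) ↔ G ≠ A) (F : Flat N) :
    kap N ⊥ F = kap M ⊥ (φ F) + kap M A (φ F) := by
  have hmua : ∀ b : Flat M, ¬ A ≤ b → IncidenceAlgebra.mu ℤ A b = 0 := fun b hb ↦
    IncidenceAlgebra.apply_eq_zero_of_not_le hb _
  have h1 : kap M A (φ F) = ∑ H ∈ Finset.Icc ⊥ (φ F),
      C (IncidenceAlgebra.mu ℤ A H) * X ^ (rk M (φ F).set - rk M H.set) := by
    refine Finset.sum_subset (Finset.Icc_subset_Icc_left bot_le) fun x hx hx' ↦ ?_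
    rw [hmua x fun h ↦ hx' (Finset.mem_Icc.2 ⟨h, (Finset.mem_Icc.1 hx).2⟩)]
    simp
  have h2 : kap M ⊥ (φ F) + kap M A (φ F) = ∑ H ∈ Finset.Icc ⊥ (φ F),
      C (IncidenceAlgebra.mu ℤ ⊥ H + IncidenceAlgebra.mu ℤ A H) *
        X ^ (rk M (φ F).set - rk M H.set) := by
    rw [h1, kap, ← Finset.sum_add_distrib]
    simp only [← add_mul, ← map_add]
  have h3 : C (IncidenceAlgebra.mu ℤ ⊥ A + IncidenceAlgebra.mu ℤ A A) *
      (X : ℤ[X]) ^ (rk M (φ F).set - rk M A.set) = 0 := by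
    rw [mu_bot_add_mu_self_of_isAtom hA, map_zero, zero_mul]
  rw [h2, ← Finset.sum_erase (a := A) _ h3, erase_Icc_bot_of_range_eq_compl φ hφ,
    Finset.sum_map, kap]
  refine Finset.sum_congr rfl fun H _ ↦ ?_
  rw [mu_of_range_eq_compl_atom φ hA hbot hφ, hr, hr]
  rfl

/-- **Deletion formula.** Suppose that the ranked lattice of flats of `N` is that of `M` with an
atom `A` removed. The contractions of `M` and of `N` by nonzero flats other than `A` then have the
same Kazhdan–Lusztig polynomials, and the two recursions differ by multiples of the recursion for
`M.contract A`. -/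
theorem klAux_eq_add_of_range_eq_compl_atom {M N : Matroid α} (φ : Flat N ↪o Flat M)
    (hr : ∀ F, rk N F.set = rk M (φ F).set) {A : Flat M} (hA : IsAtom A) (hA1 : rk M A.set = 1)
    (hφ : ∀ G, (∃ F, φ F = G) ↔ G ≠ A)
    (hdeg : 2 * ((klAux (M.contract A.set)).natDegree + 1) < rank M) :
    klAux N = klAux M + X * klAux (M.contract A.set) := by
  have hbot : φ ⊥ = ⊥ := by
    obtain ⟨F, hF⟩ := (hφ ⊥).2 hA.1.symm
    exact le_bot_iff.1 (hF ▸ φ.le_iff_le.2 bot_le)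
  have htop : φ ⊤ = ⊤ := by
    obtain ⟨F, hF⟩ := (hφ ⊤).2 fun h ↦ by
      have h1 := rank_eq M
      rw [← h] at hA1
      have : rk M M.E = 1 := hA1
      omega
    exact top_le_iff.1 (hF ▸ φ.le_iff_le.2 le_top)
  have hrank : rank N = rank M := by
    have := hr ⊤
    rw [htop] at this
    exact (rank_eq N).trans (this.trans (rank_eq M).symm)
  set Q := klAux (M.contract A.set) with hQ
  have hM0 : rank M - rk M (⊥ : Flat M).set = rank M := by rw [rk_bot, Nat.sub_zero]
  have hN0 : rank N - rk N (⊥ : Flat N).set = rank M := by rw [rk_bot, Nat.sub_zero, hrank]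
  have eM := reflect_klAux_contract_eq_add M ⊥
  have eN := reflect_klAux_contract_eq_add N ⊥
  have eA := reflect_klAux_contract M A
  rw [klAux_contract_bot, hM0, Finset.Icc_bot_top] at eM
  rw [klAux_contract_bot, hN0, Finset.Icc_bot_top] at eN
  rw [← hQ, hA1] at eA
  have hunivA : A ∈ Finset.univ.erase (⊥ : Flat M) :=
    Finset.mem_erase.2 ⟨hA.1, Finset.mem_univ _⟩
  -- the sum for `N` runs over the flats of `M` other than `⊥` and `A`
  have hsum : ∑ F ∈ Finset.univ.erase (⊥ : Flat N), kap N ⊥ F * klAux (N.contract F.set) =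
      ∑ G ∈ (Finset.univ.erase (⊥ : Flat M)).erase A,
        (kap M ⊥ G + kap M A G) * klAux (M.contract G.set) := by
    have himg : (Finset.univ.erase (⊥ : Flat M)).erase A =
        (Finset.univ.erase (⊥ : Flat N)).map φ.toEmbedding := by
      ext G
      simp only [Finset.mem_erase, Finset.mem_univ, and_true, Finset.mem_map,
        RelEmbedding.coe_toEmbedding, ← hφ]
      constructor
      · rintro ⟨⟨F, rfl⟩, h⟩
        exact ⟨F, fun hF ↦ h (by rw [hF, hbot]), rfl⟩
      · rintro ⟨F, h, rfl⟩
        exact ⟨⟨F, rfl⟩, fun hF ↦ h (φ.injective (hF.trans hbot.symm))⟩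
    rw [himg, Finset.sum_map]
    refine Finset.sum_congr rfl fun F hF ↦ ?_
    rw [kap_of_range_eq_compl_atom φ hr hA hbot hφ, klAux_contract_map φ hr F]
    · rfl
    · intro G hG
      rw [hφ]
      rintro rfl
      rcases hA.le_iff.1 hG with h | h
      · exact (Finset.mem_erase.1 hF).1 (φ.injective (h.trans hbot.symm))
      · exact (hφ _).1 ⟨F, rfl⟩ h
  have hkapA : kap M ⊥ A = X - 1 := by
    have h := sum_Icc_kap M (H := ⊥) (K := A) bot_le
    have hIcc : Finset.Icc ⊥ A = {⊥, A} := by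
      ext b
      simp only [Finset.mem_Icc, bot_le, true_and, Finset.mem_insert, Finset.mem_singleton]
      exact hA.le_iff
    rw [hIcc, Finset.sum_pair hA.1.symm, kap_self, hA1, rk_bot, Nat.sub_zero, pow_one] at h
    linear_combination h
  have hAsum : ∑ G ∈ (Finset.univ.erase (⊥ : Flat M)).erase A,
      kap M A G * klAux (M.contract G.set) = Q.reflect (rank M - 1) - Q := by
    rw [eA, ← Finset.add_sum_erase _ _ (Finset.left_mem_Icc.2 (le_top (a := A))), kap_self,
      one_mul, add_sub_cancel_left]
    refine (Finset.sum_subset ?_ fun G hG hG' ↦ ?_).symm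
    · intro G hG
      have hG := Finset.mem_erase.1 hG
      refine Finset.mem_erase.2 ⟨hG.1, Finset.mem_erase.2 ⟨?_, Finset.mem_univ _⟩⟩
      rintro rfl
      exact hA.1 (le_bot_iff.1 (Finset.mem_Icc.1 hG.2).1)
    · rw [kap_eq_zero, zero_mul]
      intro h
      exact hG' (Finset.mem_erase.2 ⟨(Finset.mem_erase.1 hG).1, Finset.mem_Icc.2 ⟨h, le_top⟩⟩)
  rw [← Finset.add_sum_erase _ _ hunivA, hkapA, ← hQ] at eM
  rw [hsum] at eN
  simp only [add_mul, Finset.sum_add_distrib, hAsum] at eN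
  have hXQ : (X * Q).reflect (rank M) = Q.reflect (rank M - 1) := by
    have h := reflect_mul (X : ℤ[X]) Q (F := 1) (G := rank M - 1) natDegree_X_le (by omega)
    rw [show 1 + (rank M - 1) = rank M by omega] at h
    rw [h, show (X : ℤ[X]).reflect 1 = 1 by simp, one_mul]
  have hdN := natDegree_klAux N (by omega)
  have hdM := natDegree_klAux M (by omega)
  have hdXQ : (X * Q).natDegree ≤ Q.natDegree + 1 :=
    natDegree_mul_le.trans (by rw [natDegree_X]; omega)
  have hdsum := natDegree_add_le (klAux M) (X * Q)
  refine eq_of_reflect_sub_eq (r := rank M) (by omega) (by omega) ?_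
  rw [reflect_add, hXQ, eN, eM]
  ring

/-! ### Boolean intervals of the lattice of flats -/

/-- The binomial theorem on the Boolean interval from `S` to `T`, in its two forms, with exponents
measured from the bottom and from the top of the interval. -/
lemma sum_Icc_pow_card_sub {ι : Type*} [DecidableEq ι] {S T : Finset ι} (h : S ⊆ T) :
    ∑ U ∈ Finset.Icc S T, (X - 1 : ℤ[X]) ^ (U.card - S.card) = X ^ (T.card - S.card) ∧
    ∑ U ∈ Finset.Icc S T, (X - 1 : ℤ[X]) ^ (T.card - U.card) = X ^ (T.card - S.card) := by
  have hinj : Set.InjOn (fun U ↦ S ∪ U) ((T \ S).powerset : Set (Finset ι)) := by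
    intro U hU V hV hUV
    have hU := Finset.subset_sdiff.1 (Finset.mem_powerset.1 hU)
    have hV := Finset.subset_sdiff.1 (Finset.mem_powerset.1 hV)
    rw [← Finset.union_sdiff_cancel_left hU.2.symm, ← Finset.union_sdiff_cancel_left hV.2.symm]
    exact congrArg (· \ S) hUV
  have hcard : ∀ U ∈ (T \ S).powerset, (S ∪ U).card = S.card + U.card := fun U hU ↦
    Finset.card_union_of_disjoint (Finset.subset_sdiff.1 (Finset.mem_powerset.1 hU)).2.symm
  have hle : ∀ U ∈ (T \ S).powerset, U.card ≤ (T \ S).card := fun U hU ↦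
    Finset.card_le_card (Finset.mem_powerset.1 hU)
  have hTS := Finset.card_sdiff_add_card_eq_card h
  rw [Finset.Icc_eq_image_powerset h, Finset.sum_image hinj, Finset.sum_image hinj,
    show T.card - S.card = (T \ S).card by omega]
  constructor
  · rw [show (X : ℤ[X]) = (X - 1) + 1 by ring, ← Finset.sum_pow_mul_eq_add_pow]
    refine Finset.sum_congr rfl fun U hU ↦ ?_
    rw [hcard U hU]
    simp
  · rw [show (X : ℤ[X]) = 1 + (X - 1) by ring, ← Finset.sum_pow_mul_eq_add_pow]
    refine Finset.sum_congr rfl fun U hU ↦ ?_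
    have := hle U hU
    rw [hcard U hU, one_pow, one_mul,
      show T.card - (S.card + U.card) = (T \ S).card - U.card by omega]
    simp

/-- The characteristic polynomial of a Boolean interval of rank `k` is `(t - 1) ^ k`: by
`sum_Icc_pow_card_sub` the powers satisfy the relation `sum_Icc_kap`, which determines the
characteristic polynomials from the top of the interval downwards. -/
lemma kap_of_boolean {ι : Type*} [Finite ι] [DecidableEq ι] {M : Matroid α} {c : ℕ}
    (g : Finset ι ↪o Flat M) (hg : ∀ G, g ∅ ≤ G → ∃ S, g S = G)
    (hr : ∀ S, rk M (g S).set = c + S.card) {S T : Finset ι} (hST : S ⊆ T) :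
    kap M (g S) (g T) = (X - 1) ^ (T.card - S.card) := by
  induction S using WellFoundedGT.induction with
  | ind S ih =>
  have h1 := sum_Icc_kap M (g.le_iff_le.2 hST)
  have h2 := (sum_Icc_pow_card_sub hST).2
  have hmem : S ∈ Finset.Icc S T := Finset.left_mem_Icc.2 hST
  rw [map_Icc g S T fun b hb _ ↦ hg b ((g.le_iff_le.2 (Finset.empty_subset S)).trans hb),
    Finset.sum_map, hr, hr, show c + T.card - (c + S.card) = T.card - S.card by omega, ← h2,
    ← Finset.add_sum_erase _ _ hmem, ← Finset.add_sum_erase _ _ hmem] at h1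
  have h3 : ∀ U ∈ (Finset.Icc S T).erase S, kap M (g.toEmbedding U) (g T) =
      (X - 1) ^ (T.card - U.card) := fun U hU ↦ by
    have hU := Finset.mem_erase.1 hU
    have hU' := Finset.mem_Icc.1 hU.2
    exact ih U (lt_of_le_of_ne hU'.1 hU.1.symm) hU'.2
  rw [Finset.sum_congr rfl h3] at h1
  exact add_right_cancel h1

/-- If the flats above a given flat form a Boolean lattice, then the contraction by this flat has
Kazhdan–Lusztig polynomial one. -/
lemma klAux_contract_of_boolean {ι : Type*} [Finite ι] [DecidableEq ι] {M : Matroid α} {c : ℕ}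
    (g : Finset ι ↪o Flat M) (hg : ∀ G, g ∅ ≤ G → ∃ S, g S = G)
    (hr : ∀ S, rk M (g S).set = c + S.card) (S : Finset ι) :
    klAux (M.contract (g S).set) = 1 := by
  have := Fintype.ofFinite ι
  induction S using WellFoundedGT.induction with
  | ind S ih =>
  have htop : g Finset.univ = ⊤ := by
    obtain ⟨H, hH⟩ := hg ⊤ le_top
    exact top_le_iff.1 (hH ▸ g.le_iff_le.2 (Finset.subset_univ H))
  have hrank : rank M = c + (Finset.univ : Finset ι).card := by
    rw [← hr, htop]
    exact rank_eq M
  have hS := Finset.card_le_univ S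
  rw [← Finset.card_univ] at hS
  rcases hS.eq_or_lt with h | h
  · exact klAux_contract_of_rank_eq (by rw [hrank, hr, h])
  have e : rank M - rk M (g S).set = (Finset.univ : Finset ι).card - S.card := by
    rw [hrank, hr]
    omega
  refine eq_of_reflect_sub_eq (two_mul_natDegree_klAux_contract (by rw [hrank, hr]; omega))
    (by rw [natDegree_one]; omega) ?_
  have h0 := (sum_Icc_pow_card_sub (Finset.subset_univ S)).1
  have hmem : S ∈ Finset.Icc S Finset.univ := Finset.left_mem_Icc.2 (Finset.subset_univ S)
  have hX : (1 : ℤ[X]).reflect (rank M - rk M (g S).set) =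
      X ^ ((Finset.univ : Finset ι).card - S.card) := by
    rw [reflect_one, e]
  rw [hX, ← h0, reflect_klAux_contract_eq_add, add_sub_cancel_left, ← Finset.add_sum_erase _ _ hmem,
    Nat.sub_self, pow_zero, add_sub_cancel_left]
  have hIcc : (Finset.Icc (g S) ⊤).erase (g S) =
      ((Finset.Icc S Finset.univ).erase S).map g.toEmbedding := by
    rw [← htop, map_Icc g S Finset.univ fun b hb _ ↦
      hg b ((g.le_iff_le.2 (Finset.empty_subset S)).trans hb), Finset.map_erase]
    rfl
  rw [hIcc, Finset.sum_map]
  refine Finset.sum_congr rfl fun T hT ↦ ?_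
  have hT := Finset.mem_erase.1 hT
  have hST := (Finset.mem_Icc.1 hT.2).1
  rw [RelEmbedding.coe_toEmbedding, kap_of_boolean g hg hr hST,
    ih T (lt_of_le_of_ne hST hT.1.symm), mul_one]

end KazhdanLusztig
/-! ### Flats of a restriction -/

section Restriction

variable {α : Type*} [Finite α]

/-- The embedding of the flats of the restriction of `M` to `R` into the flats of `M` that sends
a flat to its closure in `M`. -/
noncomputable def restrictClosureEmb (M : Matroid α) {R : Set α} (hR : R ⊆ M.E) :
    Flat (M.restrict R) ↪o Flat M :=
  OrderEmbedding.ofMapLEIff (fun H ↦ ⟨M.closure H.set, M.isFlat_closure _⟩) fun H K ↦ by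
    have hcl : ∀ L : Flat (M.restrict R), M.closure L.set ∩ R = L.set := fun L ↦ by
      rw [← M.restrict_closure_eq (R := R) L.subset_ground hR]
      exact L.closure_eq
    constructor
    · intro h
      rw [Flat.le_iff, ← hcl H, ← hcl K]
      exact Set.inter_subset_inter_left _ h
    · exact fun h ↦ M.closure_subset_closure h

lemma restrictClosureEmb_set (M : Matroid α) {R : Set α} (hR : R ⊆ M.E)
    (F : Flat (M.restrict R)) : (restrictClosureEmb M hR F).set = M.closure F.set := rfl

lemma rk_restrictClosureEmb (M : Matroid α) {R : Set α} (hR : R ⊆ M.E)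
    (F : Flat (M.restrict R)) : rk (M.restrict R) F.set = rk M (restrictClosureEmb M hR F).set := by
  rw [restrictClosureEmb_set, rk_restrict M (R := R) F.subset_ground, rk, rk, M.eRk_closure_eq]

lemma exists_restrictClosureEmb {M : Matroid α} {R : Set α} (hR : R ⊆ M.E) {G : Flat M}
    (hG : G.set ⊆ M.closure (G.set ∩ R)) : ∃ F, restrictClosureEmb M hR F = G := by
  have hcl : (M.restrict R).closure (G.set ∩ R) = M.closure (G.set ∩ R) ∩ R :=
    M.restrict_closure_eq Set.inter_subset_right hR
  refine ⟨⟨(M.restrict R).closure (G.set ∩ R), Matroid.isFlat_closure _⟩, Flat.ext ?_⟩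
  change M.closure ((M.restrict R).closure (G.set ∩ R)) = G.set
  have hGcl : M.closure (G.set ∩ R) ⊆ G.set :=
    (M.closure_subset_closure Set.inter_subset_left).trans G.closure_eq.subset
  rw [hcl]
  refine subset_antisymm ?_ (hG.trans (M.closure_subset_closure ?_))
  · exact (M.closure_subset_closure (Set.inter_subset_left.trans hGcl)).trans G.closure_eq.subset
  · exact Set.subset_inter (Set.inter_subset_left.trans hG) Set.inter_subset_right

end Restriction

/-! ### Stars and triangles in graphical matroids -/

section Graph

variable {V : Type*} [Finite V]

lemma graphicMatroid_restrict {G H : SimpleGraph V} (h : H ≤ G) :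
    (graphicMatroid G).restrict H.edgeSet = graphicMatroid H := by
  refine Matroid.ext_indep rfl fun I _ ↦ ?_
  rw [Matroid.restrict_indep_iff, graphicMatroid_indep_iff, graphicMatroid_indep_iff]
  exact ⟨fun hI ↦ ⟨hI.2, hI.1.2⟩,
    fun hI ↦ ⟨⟨hI.1.trans (SimpleGraph.edgeSet_mono h), hI.2⟩, hI.1⟩⟩

lemma graphicMatroid_indep_of_star {G : SimpleGraph V} (c : V) {I : Set (Sym2 V)}
    (hI : I ⊆ G.edgeSet) (hc : ∀ f ∈ I, c ∈ f) : (graphicMatroid G).Indep I := by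
  refine ⟨hI, (SimpleGraph.isAcyclic_starGraph c).anti fun x y hxy ↦ ?_⟩
  have hxy := (SimpleGraph.fromEdgeSet_adj I).1 hxy
  rw [SimpleGraph.starGraph_adj]
  refine ⟨hxy.2, ?_⟩
  rcases Sym2.mem_iff.1 (hc _ hxy.1) with h | h
  · exact Or.inl h.symm
  · exact Or.inr h.symm

lemma mem_closure_pair_of_triangle {G : SimpleGraph V} {x y z : V} (hxy : G.Adj x y)
    (hxz : G.Adj x z) (hyz : G.Adj y z) :
    s(x, y) ∈ (graphicMatroid G).closure {s(x, z), s(y, z)} := by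
  classical
  have hsub : ({s(x, z), s(y, z)} : Set (Sym2 V)) ⊆ G.edgeSet := by
    rintro _ (rfl | rfl)
    exacts [hxz, hyz]
  have hI : (graphicMatroid G).Indep {s(x, z), s(y, z)} := by
    refine graphicMatroid_indep_of_star z hsub ?_
    rintro _ (rfl | rfl) <;> simp
  rw [hI.mem_closure_iff]
  refine Or.inl ⟨fun h ↦ ?_, Set.insert_subset hxy hsub⟩
  refine h.2.cliqueFree le_rfl {x, y, z} (SimpleGraph.is3Clique_triple_iff.2 ?_)
  simp only [SimpleGraph.fromEdgeSet_adj]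
  exact ⟨⟨Or.inl rfl, hxy.ne⟩, ⟨Or.inr (Or.inl rfl), hxz.ne⟩, ⟨Or.inr (Or.inr rfl), hyz.ne⟩⟩

end Graph

/-! ### The flats of the thagomizer matroid -/

section Thagomizer

variable {n : ℕ}

/-- The edge of the thagomizer graph that joins the two vertices of the part of size two. -/
def spine (n : ℕ) : Sym2 (Fin 2 ⊕ Fin n) := s(Sum.inl 0, Sum.inl 1)

/-- The edge joining a vertex of the part of size two and a vertex of the part of size `n`. -/
def spike (c : Fin 2) (i : Fin n) : Sym2 (Fin 2 ⊕ Fin n) := s(Sum.inl c, Sum.inr i)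

lemma thagomizerGraph_adj_inl {c d : Fin 2} (h : c ≠ d) :
    (thagomizerGraph n).Adj (Sum.inl c) (Sum.inl d) := by
  refine Or.inr ((SimpleGraph.edge_adj _ _ _ _).2 ⟨?_, by simpa using h⟩)
  fin_cases c <;> fin_cases d <;> simp_all

lemma thagomizerGraph_adj_inl_inr (c : Fin 2) (i : Fin n) :
    (thagomizerGraph n).Adj (Sum.inl c) (Sum.inr i) :=
  Or.inl (Or.inl ⟨rfl, rfl⟩)

lemma mem_edgeSet_completeBipartiteGraph {f : Sym2 (Fin 2 ⊕ Fin n)} :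
    f ∈ (completeBipartiteGraph (Fin 2) (Fin n)).edgeSet ↔ ∃ c i, f = spike c i := by
  constructor
  · induction f using Sym2.ind with
    | _ u v =>
    rintro (h | h)
    · rcases u with c | i <;> rcases v with d | j <;> simp at h
      exact ⟨c, j, rfl⟩
    · rcases u with c | i <;> rcases v with d | j <;> simp at h
      exact ⟨d, i, Sym2.eq_swap⟩
  · rintro ⟨c, i, rfl⟩
    exact Or.inl ⟨rfl, rfl⟩

lemma mem_edgeSet_thagomizerGraph {f : Sym2 (Fin 2 ⊕ Fin n)} :
    f ∈ (thagomizerGraph n).edgeSet ↔ f = spine n ∨ ∃ c i, f = spike c i := by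
  rw [← mem_edgeSet_completeBipartiteGraph, thagomizerGraph, SimpleGraph.edgeSet_sup,
    Set.mem_union, SimpleGraph.edgeSet_edge_of_ne (by simp), Set.mem_singleton_iff, or_comm, spine]

lemma spike_ne_spine (c : Fin 2) (i : Fin n) : spike c i ≠ spine n := by
  simp [spike, spine]

lemma spike_injective (c : Fin 2) : Function.Injective (spike c : Fin n → _) := fun i j h ↦ by
  simpa [spike] using h

lemma spine_eq {c d : Fin 2} (h : c ≠ d) : spine n = s(Sum.inl c, Sum.inl d) := by
  fin_cases c <;> fin_cases d <;> simp_all [spine]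

lemma spine_mem_closure (i : Fin n) {c d : Fin 2} (h : c ≠ d) :
    spine n ∈ (graphicMatroid (thagomizerGraph n)).closure {spike c i, spike d i} := by
  rw [spine_eq h]
  exact mem_closure_pair_of_triangle (thagomizerGraph_adj_inl h)
    (thagomizerGraph_adj_inl_inr c i) (thagomizerGraph_adj_inl_inr d i)

lemma spike_mem_closure (i : Fin n) {c d : Fin 2} (h : c ≠ d) :
    spike c i ∈ (graphicMatroid (thagomizerGraph n)).closure {spine n, spike d i} := by
  have := mem_closure_pair_of_triangle (thagomizerGraph_adj_inl_inr c i)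
    (thagomizerGraph_adj_inl h) (thagomizerGraph_adj_inl_inr d i).symm
  rwa [← spine_eq h, Sym2.eq_swap (a := Sum.inr i)] at this

lemma spike_mem_of_mem {F : Flat (graphicMatroid (thagomizerGraph n))} (hs : spine n ∈ F.set)
    {i : Fin n} {c d : Fin 2} (h : c ≠ d) (hd : spike d i ∈ F.set) : spike c i ∈ F.set := by
  rw [← F.closure_eq]
  exact Matroid.closure_subset_closure _ (Set.pair_subset hs hd) (spike_mem_closure i h)

lemma indep_insert_spine_image_spike (c : Fin 2) (S : Set (Fin n)) :
    (graphicMatroid (thagomizerGraph n)).Indep (insert (spine n) (spike c '' S)) := by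
  refine graphicMatroid_indep_of_star (Sum.inl c) ?_ ?_
  · rintro _ (rfl | ⟨i, -, rfl⟩)
    · exact mem_edgeSet_thagomizerGraph.2 (Or.inl rfl)
    · exact mem_edgeSet_thagomizerGraph.2 (Or.inr ⟨c, i, rfl⟩)
  · rintro _ (rfl | ⟨i, -, rfl⟩)
    · fin_cases c <;> simp [spine]
    · simp [spike]

lemma spike_mem_closure_iff (c : Fin 2) (S : Set (Fin n)) (i : Fin n) :
    spike c i ∈ (graphicMatroid (thagomizerGraph n)).closure (insert (spine n) (spike c '' S)) ↔
      i ∈ S := by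
  constructor
  · intro h
    by_contra hi
    refine ((indep_insert_spine_image_spike c S).notMem_closure_iff_of_notMem ?_ ?_).2 ?_ h
    · rintro (h | h)
      · exact spike_ne_spine c i h
      · exact hi ((spike_injective c).mem_set_image.1 h)
    · exact mem_edgeSet_thagomizerGraph.2 (Or.inr ⟨c, i, rfl⟩)
    · rw [Set.insert_comm, ← Set.image_insert_eq]
      exact indep_insert_spine_image_spike c _
  · intro h
    exact Matroid.mem_closure_of_mem _ (Or.inr ⟨i, h, rfl⟩)
      (indep_insert_spine_image_spike c S).subset_ground

/-- The flats of the thagomizer matroid that contain the spine, as the image of the Boolean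
lattice: the set `S` corresponds to the flat consisting of the spine and the pairs of spikes at the
vertices in `S`. -/
noncomputable def spineFlat (n : ℕ) :
    Finset (Fin n) ↪o Flat (graphicMatroid (thagomizerGraph n)) :=
  OrderEmbedding.ofMapLEIff
    (fun S ↦ ⟨(graphicMatroid (thagomizerGraph n)).closure (insert (spine n) (spike 0 '' S)),
      Matroid.isFlat_closure _⟩)
    fun S T ↦ by
      constructor
      · intro h i hi
        exact (spike_mem_closure_iff 0 (T : Set (Fin n)) i).1
          (h ((spike_mem_closure_iff 0 (S : Set (Fin n)) i).2 hi))
      · exact fun h ↦ Matroid.closure_subset_closure _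
          (Set.insert_subset_insert (Set.image_mono h))

lemma spineFlat_set (S : Finset (Fin n)) : (spineFlat n S).set =
    (graphicMatroid (thagomizerGraph n)).closure (insert (spine n) (spike 0 '' S)) := rfl

lemma rk_spineFlat (S : Finset (Fin n)) :
    rk (graphicMatroid (thagomizerGraph n)) (spineFlat n S).set = 1 + S.card := by
  have hns : spine n ∉ spike 0 '' (S : Set (Fin n)) := by
    rintro ⟨i, -, h⟩
    exact spike_ne_spine 0 i h
  rw [spineFlat_set, rk, Matroid.eRk_closure_eq,
    (indep_insert_spine_image_spike 0 (S : Set (Fin n))).eRk_eq_encard,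
    Set.encard_insert_of_notMem hns, (spike_injective 0).encard_image,
    Set.encard_coe_eq_coe_finsetCard, add_comm]
  rfl

lemma spine_mem_spineFlat (S : Finset (Fin n)) : spine n ∈ (spineFlat n S).set :=
  Matroid.mem_closure_of_mem _ (Or.inl rfl) (indep_insert_spine_image_spike 0 _).subset_ground

lemma exists_spineFlat {G : Flat (graphicMatroid (thagomizerGraph n))}
    (hG : spine n ∈ G.set) : ∃ S, spineFlat n S = G := by
  classical
  refine ⟨Finset.univ.filter fun i ↦ spike 0 i ∈ G.set, Flat.ext (subset_antisymm ?_ ?_)⟩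
  · rw [spineFlat_set, ← G.closure_eq]
    refine Matroid.closure_subset_closure_of_subset_closure ?_
    rw [G.closure_eq]
    rintro _ (rfl | ⟨i, hi, rfl⟩)
    · exact hG
    · simpa using hi
  · intro f hf
    rcases mem_edgeSet_thagomizerGraph.1 (G.subset_ground hf) with rfl | ⟨c, i, rfl⟩
    · exact spine_mem_spineFlat _
    · have h0 : spike 0 i ∈ G.set := by
        rcases eq_or_ne 0 c with rfl | h
        · exact hf
        · exact spike_mem_of_mem hG h hf
      have h1 : spike 0 i ∈
          (spineFlat n (Finset.univ.filter fun i ↦ spike 0 i ∈ G.set)).set :=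
        (spike_mem_closure_iff 0 _ i).2 (by simpa using h0)
      rcases eq_or_ne c 0 with rfl | h
      · exact h1
      · exact spike_mem_of_mem (spine_mem_spineFlat _) h h1

lemma spineFlat_empty_set : (spineFlat n ∅).set = {spine n} := by
  refine subset_antisymm (fun f hf ↦ ?_) (Set.singleton_subset_iff.2 (spine_mem_spineFlat _))
  rcases mem_edgeSet_thagomizerGraph.1 ((spineFlat n ∅).subset_ground hf) with rfl | ⟨c, i, rfl⟩
  · rfl
  · have h := (spike_mem_closure_iff c ∅ i).1
    rw [spineFlat_set] at hf
    simp only [Finset.coe_empty, Set.image_empty] at hf h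
    exact (h hf).elim

lemma isAtom_spineFlat_empty : IsAtom (spineFlat n ∅) := by
  constructor
  · intro h
    have := rk_spineFlat (n := n) ∅
    rw [h, rk_bot] at this
    simp at this
  · intro G hG
    have hsub : G.set ⊆ {spine n} := by
      rw [← spineFlat_empty_set]
      exact hG.le
    rcases Set.subset_singleton_iff_eq.1 hsub with h | h
    · refine le_bot_iff.1 (Flat.le_iff.2 ?_)
      rw [h]
      exact Set.empty_subset _
    · exact (hG.ne (Flat.ext (h.trans spineFlat_empty_set.symm))).elim

lemma klAux_contract_spine :
    klAux ((graphicMatroid (thagomizerGraph n)).contract (spineFlat n ∅).set) = 1 :=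
  klAux_contract_of_boolean (spineFlat n)
    (fun _ hG ↦ exists_spineFlat (hG (spine_mem_spineFlat ∅))) rk_spineFlat ∅

lemma completeBipartiteGraph_le_thagomizerGraph :
    completeBipartiteGraph (Fin 2) (Fin n) ≤ thagomizerGraph n := le_sup_left

lemma edgeSet_completeBipartiteGraph_subset :
    (completeBipartiteGraph (Fin 2) (Fin n)).edgeSet ⊆
      (graphicMatroid (thagomizerGraph n)).E :=
  SimpleGraph.edgeSet_mono completeBipartiteGraph_le_thagomizerGraph

/-- A flat of the thagomizer matroid other than the spine is spanned by its spikes: if it contains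
the spine and a spike, then it contains a triangle. -/
lemma exists_restrictClosureEmb_iff (G : Flat (graphicMatroid (thagomizerGraph n))) :
    (∃ F, restrictClosureEmb (graphicMatroid (thagomizerGraph n))
      edgeSet_completeBipartiteGraph_subset F = G) ↔ G ≠ spineFlat n ∅ := by
  constructor
  · rintro ⟨F, rfl⟩ hF
    have hset := congrArg Flat.set hF
    rw [restrictClosureEmb_set, spineFlat_empty_set] at hset
    have hFE : F.set ⊆ (completeBipartiteGraph (Fin 2) (Fin n)).edgeSet := F.subset_ground
    have hFs : F.set ⊆ {spine n} := by
      rw [← hset]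
      exact Matroid.subset_closure _ _ (hFE.trans edgeSet_completeBipartiteGraph_subset)
    have hempty : F.set = ∅ := by
      refine Set.eq_empty_of_forall_notMem fun f hf ↦ ?_
      obtain ⟨c, i, rfl⟩ := mem_edgeSet_completeBipartiteGraph.1 (hFE hf)
      exact spike_ne_spine c i (hFs hf)
    refine (isAtom_spineFlat_empty (n := n)).1 (le_bot_iff.1 (Flat.le_iff.2 ?_))
    rw [← hF, restrictClosureEmb_set, hempty]
    exact subset_rfl
  · intro hG
    refine exists_restrictClosureEmb _ fun f hf ↦ ?_
    have hspike : ∀ c i, spike c i ∈ G.set →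
        spike c i ∈ G.set ∩ (completeBipartiteGraph (Fin 2) (Fin n)).edgeSet := fun c i h ↦
      ⟨h, mem_edgeSet_completeBipartiteGraph.2 ⟨c, i, rfl⟩⟩
    rcases mem_edgeSet_thagomizerGraph.1 (G.subset_ground hf) with rfl | ⟨c, i, rfl⟩
    · obtain ⟨c, i, hci⟩ : ∃ c i, spike c i ∈ G.set := by
        by_contra! hcon
        refine hG (Flat.ext ?_)
        rw [spineFlat_empty_set]
        refine subset_antisymm (fun g hg ↦ ?_) (Set.singleton_subset_iff.2 hf)
        rcases mem_edgeSet_thagomizerGraph.1 (G.subset_ground hg) with rfl | ⟨c, i, rfl⟩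
        · rfl
        · exact (hcon c i hg).elim
      obtain ⟨d, hd⟩ := exists_ne c
      exact Matroid.closure_subset_closure _
        (Set.pair_subset (hspike d i (spike_mem_of_mem hf hd hci)) (hspike c i hci))
        (spine_mem_closure i hd)
    · exact Matroid.mem_closure_of_mem _ (hspike c i hf)
        (Set.inter_subset_left.trans G.subset_ground)

end Thagomizer
end MatroidKL

open MatroidKL in
theorem mainTheorem3 (n : ℕ) (hn : 2 ≤ n) :
    MatroidKL.klPolynomial (MatroidKL.graphicMatroid (completeBipartiteGraph (Fin 2) (Fin n))) =
      MatroidKL.klPolynomial (MatroidKL.graphicMatroid (MatroidKL.thagomizerGraph n)) +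
        Polynomial.X := by
  have hrank := rk_le_rank (graphicMatroid (thagomizerGraph n)) (spineFlat n Finset.univ).set
  rw [rk_spineFlat, Finset.card_univ, Fintype.card_fin] at hrank
  have h := klAux_eq_add_of_range_eq_compl_atom (A := spineFlat n ∅)
    (restrictClosureEmb _ edgeSet_completeBipartiteGraph_subset)
    (rk_restrictClosureEmb _ _) isAtom_spineFlat_empty (by rw [rk_spineFlat]; rfl)
    exists_restrictClosureEmb_iff
    (by rw [klAux_contract_spine, natDegree_one]; omega)
  rw [klAux_contract_spine, mul_one,
    graphicMatroid_restrict completeBipartiteGraph_le_thagomizerGraph] at h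
  rw [isKLAssignment_klPolynomial.eq_klAux, isKLAssignment_klPolynomial.eq_klAux, h]
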